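/- Let $N\in\mathbb N$ and let $H$ be a separable complex Hilbert lattice. That is, $H=E\oplus iE$ is the complexification, as a Hilbert space, of a real Hilbert lattice $E$ (a real Hilbert space with a vector lattice order such that $|a|\le|b|$ implies $\|a\|\le\|b\|$), with modulus $|a+ib|=\sup_{\theta\in\mathbb R}\big((\cos\theta)a+(\sin\theta)b\big)\in E$ for $a,b\in E$. A closed ideal of $H$ is a closed linear subspace $I\subseteq H$ such that $z\in I$, $w\in H$ and $|w|\le|z|$ imply $w\in I$. A closed ideal of the Bochner space $\mathcal H=L^2(\mathbb R^N;H)$ (Lebesgue measure) is a closed linear subspace $\mathcal I\subseteq\mathcal H$ such that $f\in\mathcal I$, $g\in\mathcal H$ and $|g(x)|\le|f(x)|$ for a.e. $x\in\mathbb R^N$ imply $g\in\mathcal I$. Let $\mathcal P$ be an orthogonal projection of $\mathcal H$ onto a closed ideal of $\mathcal H$. Then: 1. $\mathcal P$ is strictly local: there is a family $(P_x)_{x\in\mathbb R^N}$ of orthogonal projections of $H$ onto closed subspaces of $H$ which is strongly measurable (i.e. $x\mapsto P_xv$ is Lebesgue measurable, as an $H$-valued map in the sense of Bochner, for each $v\in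 H$) and satisfies, for every $f\in\mathcal H$, $$(\mathcal Pf)(x)=P_x(f(x))\qquad\text{for a.e. }x\in\mathbb R^N .$$ 2. For every family $(P_x)_{x\in\mathbb R^N}$ as in 1, the range of $P_x$ is a closed ideal of $H$ for a.e. $x\in\mathbb R^N$. -/

import Mathlib

open MeasureTheory Set
open scoped InnerProductSpace ENNReal

noncomputable section

namespace HilbertLattice

theorem smul_le_abs {E : Type*} [AddCommGroup E] [Module ℝ E] [Lattice E] [IsOrderedAddMonoid E]
    [IsOrderedModule ℝ E] (c : ℝ) (hc : |c| ≤ 1) (a : E) : c • a ≤ |a| := by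
  obtain ⟨h1, h2⟩ := abs_le.1 hc
  have e : |a| - c • a = ((1 + c) / 2) • (|a| - a) + ((1 - c) / 2) • (|a| + a) := by module
  have p : 0 ≤ |a| - c • a := by
    rw [e]
    refine add_nonneg (smul_nonneg (by linarith) (sub_nonneg.2 (le_abs_self a)))
      (smul_nonneg (by linarith) ?_)
    have := neg_le_abs a
    exact neg_le_iff_add_nonneg.1 this
  exact sub_nonneg.1 p

section RealLattice

variable {E : Type*} [NormedAddCommGroup E] [InnerProductSpace ℝ E] [CompleteSpace E]
  [Lattice E] [IsOrderedAddMonoid E] [IsOrderedModule ℝ E] [HasSolidNorm E]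

/-- A real Hilbert lattice is order complete. -/
theorem exists_isLUB {S : Set E} (hne : S.Nonempty) (hb : BddAbove S) : ∃ m, IsLUB S m := by
  obtain ⟨s, hs⟩ := hne
  set U : Set E := {w | ∀ t ∈ S, t - s ≤ w} with hU
  have hUne : U.Nonempty := by
    obtain ⟨b, hb⟩ := hb
    exact ⟨b - s, fun t ht => sub_le_sub_right (hb ht) s⟩
  have hUcl : IsClosed U := by
    have : U = ⋂ t ∈ S, Ici (t - s) := by ext w; simp [hU]
    rw [this]
    exact isClosed_biInter fun t _ => isClosed_Ici
  have hUcv : Convex ℝ U := by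
    have : U = ⋂ t ∈ S, Ici (t - s) := by ext w; simp [hU]
    rw [this]
    exact convex_iInter₂ fun t _ => convex_Ici (𝕜 := ℝ) (t - s)
  have hpos : ∀ w ∈ U, 0 ≤ w := fun w hw => by simpa using hw s hs
  obtain ⟨m, hm, hmin⟩ := exists_norm_eq_iInf_of_complete_convex hUne hUcl.isComplete hUcv 0
  have hvar := (norm_eq_iInf_iff_real_inner_le_zero hUcv hm).1 hmin
  refine ⟨m + s, fun t ht => sub_le_iff_le_add.1 (hm t ht), fun u hu => ?_⟩
  have hu' : u - s ∈ U := fun t ht => sub_le_sub_right (hu ht) s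
  set w : E := m ⊓ (u - s) with hw
  have hwU : w ∈ U := fun t ht => le_inf (hm t ht) (hu' t ht)
  have hwm : ‖w‖ ≤ ‖m‖ := by
    apply HasSolidNorm.solid
    rw [abs_of_nonneg (hpos w hwU), abs_of_nonneg (hpos m hm)]
    exact inf_le_left
  have h1 := hvar w hwU
  rw [zero_sub, inner_neg_left, inner_sub_right, real_inner_self_eq_norm_sq] at h1
  have h2 := norm_sub_sq_real m w
  have h3 : ‖w‖ ^ 2 ≤ ‖m‖ ^ 2 := by gcongr
  have h4 : ‖m - w‖ = 0 := by
    have : ‖m - w‖ ^ 2 ≤ 0 := by linarith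
    exact pow_eq_zero_iff (two_ne_zero) |>.1 (le_antisymm this (sq_nonneg _))
  have h5 : m = w := sub_eq_zero.1 (norm_eq_zero.1 h4)
  have h6 : m ≤ u - s := h5.trans_le inf_le_right
  exact le_sub_iff_add_le.1 h6

theorem exists_isLUB_rotations (a b : E) :
    ∃ m, IsLUB (range fun θ : ℝ => Real.cos θ • a + Real.sin θ • b) m := by
  refine exists_isLUB (range_nonempty _) ⟨|a| + |b|, ?_⟩
  rintro _ ⟨θ, rfl⟩
  exact add_le_add (smul_le_abs _ (Real.abs_cos_le_one θ) a)
    (smul_le_abs _ (Real.abs_sin_le_one θ) b)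

end RealLattice

/-- The complex Hilbert space `H` is the (Hilbert space) complexification of the real Hilbert
space `E`: `E` sits in `H` as a real form on which the inner product is the one of `E`,
and every `z : H` is `re z + i im z`. When `E` is a real Hilbert lattice, this is the structure of a
complex Hilbert lattice on `H`. -/
structure Complexification (E H : Type*) [NormedAddCommGroup E] [InnerProductSpace ℝ E]
    [NormedAddCommGroup H] [InnerProductSpace ℂ H] where
  ofReal : E →ₗ[ℝ] H
  re : H → E
  im : H → E
  ofReal_re_add_I_smul_ofReal_im : ∀ z : H, ofReal (re z) + Complex.I • ofReal (im z) = z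
  inner_ofReal : ∀ a b : E, ⟪ofReal a, ofReal b⟫_ℂ = ((⟪a, b⟫_ℝ : ℝ) : ℂ)

section ComplexLattice

variable {E H : Type*} [NormedAddCommGroup E] [InnerProductSpace ℝ E] [CompleteSpace E]
  [Lattice E] [IsOrderedAddMonoid E] [IsOrderedModule ℝ E] [HasSolidNorm E]
  [NormedAddCommGroup H] [InnerProductSpace ℂ H]

/-- The modulus of a complex Hilbert lattice,
`|a + i b| = sup {(cos θ) a + (sin θ) b : θ ∈ ℝ}`, an element of the real part `E`. -/
def Complexification.modulus (C : Complexification E H) (z : H) : E :=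
  Classical.choose (exists_isLUB_rotations (C.re z) (C.im z))

theorem Complexification.isLUB_modulus (C : Complexification E H) (z : H) :
    IsLUB (range fun θ : ℝ => Real.cos θ • C.re z + Real.sin θ • C.im z) (C.modulus z) :=
  Classical.choose_spec (exists_isLUB_rotations (C.re z) (C.im z))

/-- Closed ideals of the complex Hilbert lattice `H`. -/
structure IsClosedIdeal (C : Complexification E H) (I : Submodule ℂ H) : Prop where
  isClosed : IsClosed (I : Set H)
  mem_of_modulus_le : ∀ z ∈ I, ∀ w : H, C.modulus w ≤ C.modulus z → w ∈ I

/-- Closed ideals of `L²(μ; H)`, which is ordered pointwise almost everywhere. -/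
structure IsClosedIdealL2 {X : Type*} [MeasurableSpace X] {μ : Measure X}
    (C : Complexification E H) (I : Submodule ℂ (Lp H 2 μ)) : Prop where
  isClosed : IsClosed (I : Set (Lp H 2 μ))
  mem_of_modulus_le : ∀ f ∈ I, ∀ g : Lp H 2 μ,
    (∀ᵐ x ∂μ, C.modulus (g x) ≤ C.modulus (f x)) → g ∈ I

end ComplexLattice

section StrictlyLocal

variable {X : Type*} [MeasurableSpace X] {μ : Measure X}
  {H : Type*} [NormedAddCommGroup H] [InnerProductSpace ℂ H] [CompleteSpace H]

/-- `(P x)` is a strongly measurable family of orthogonal projections of `H` (that is,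
`x ↦ P x v` is measurable for every `v : H`) through which `T` acts pointwise:
`(T f)(x) = P x (f x)` almost everywhere, for every `f` in `L²(μ; H)`. -/
structure ActsThrough (T : Lp H 2 μ →L[ℂ] Lp H 2 μ) (P : X → H →L[ℂ] H) : Prop where
  isStarProjection : ∀ x, IsStarProjection (P x)
  aestronglyMeasurable : ∀ v : H, AEStronglyMeasurable (fun x => P x v) μ
  ae_eq : ∀ f : Lp H 2 μ, ∀ᵐ x ∂μ, T f x = P x (f x)

/-- Strictly local operators on `L²(μ; H)`. -/
def StrictlyLocal (T : Lp H 2 μ →L[ℂ] Lp H 2 μ) : Prop :=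
  ∃ P : X → H →L[ℂ] H, ActsThrough T P

end StrictlyLocal

end HilbertLattice

end

open HilbertLattice

open Filter Topology

namespace HilbertLattice

section Complexification

variable {E H : Type*} [NormedAddCommGroup E] [InnerProductSpace ℝ E]
  [NormedAddCommGroup H] [InnerProductSpace ℂ H] (C : Complexification E H)

namespace Complexification

/-! Strict locality: a closed ideal of `L²(μ; H)` is stable under multiplication by indicators, so
its elements are pointwise orthogonal a.e. to those of its complement
(`ae_inner_eq_zero_of_mem_orthogonal`). Hence `T` is, in each fibre, the projection onto the closed
span of the values of a countable dense family in its range.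

Ideal fibres: for `f ≥ 0`, the truncation `(Re T f)⁺ ⊓ f` stays in the ideal and is no farther from
`f` than `T f`, so it equals `T f`. Thus `0 ≤ T f ≤ f` (`ae_mem_Icc_of_isClosedIdealL2`). Testing on
locally constant functions with values in a countable dense set gives `0 ≤ P x a ≤ a` for all `a ≥
0`, for a.e. `x`. A projection with this property has an ideal as range
(`isClosedIdeal_range_of_mem_Icc`). -/

theorem norm_sq_ofReal_add_I_smul (a b : E) :
    ‖C.ofReal a + Complex.I • C.ofReal b‖ ^ 2 = ‖a‖ ^ 2 + ‖b‖ ^ 2 := by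
  have h : ⟪C.ofReal a + Complex.I • C.ofReal b, C.ofReal a + Complex.I • C.ofReal b⟫_ℂ
      = ((‖a‖ ^ 2 + ‖b‖ ^ 2 : ℝ) : ℂ) := by
    rw [inner_add_left, inner_add_right, inner_add_right, inner_smul_left, inner_smul_left,
      inner_smul_right, inner_smul_right, C.inner_ofReal, C.inner_ofReal, C.inner_ofReal,
      C.inner_ofReal, real_inner_comm a b, real_inner_self_eq_norm_sq, real_inner_self_eq_norm_sq,
      Complex.conj_I]
    push_cast
    linear_combination (-(‖b‖ : ℂ) ^ 2) * Complex.I_sq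
  rw [inner_self_eq_norm_sq_to_K] at h
  exact Complex.ofReal_injective ((Complex.ofReal_pow _ 2).trans h)

theorem norm_sq_eq (z : H) : ‖z‖ ^ 2 = ‖C.re z‖ ^ 2 + ‖C.im z‖ ^ 2 := by
  rw [← C.norm_sq_ofReal_add_I_smul, C.ofReal_re_add_I_smul_ofReal_im]

theorem norm_re_le (z : H) : ‖C.re z‖ ≤ ‖z‖ := by
  refine (sq_le_sq₀ (norm_nonneg _) (norm_nonneg _)).1 ?_
  rw [C.norm_sq_eq z]
  exact le_add_of_nonneg_right (sq_nonneg _)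

theorem norm_ofReal (a : E) : ‖C.ofReal a‖ = ‖a‖ := by
  have := C.norm_sq_ofReal_add_I_smul a 0
  rw [map_zero, smul_zero, add_zero, norm_zero] at this
  exact (sq_eq_sq₀ (norm_nonneg _) (norm_nonneg _)).1 (by simpa using this)

/-- The structure only asserts that a decomposition exists; uniqueness follows from the Pythagorean
identity applied to the difference of two decompositions. -/
theorem re_im_eq_of_eq {z : H} {a b : E} (h : C.ofReal a + Complex.I • C.ofReal b = z) :
    C.re z = a ∧ C.im z = b := by
  have h0 : C.ofReal (C.re z - a) + Complex.I • C.ofReal (C.im z - b) = 0 := by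
    rw [map_sub, map_sub, smul_sub, sub_add_sub_comm, C.ofReal_re_add_I_smul_ofReal_im, h, sub_self]
  have h1 := C.norm_sq_ofReal_add_I_smul (C.re z - a) (C.im z - b)
  rw [h0, norm_zero] at h1
  have ha := sq_nonneg ‖C.re z - a‖
  have hb := sq_nonneg ‖C.im z - b‖
  exact ⟨sub_eq_zero.1 (norm_eq_zero.1 (pow_eq_zero_iff two_ne_zero |>.1 (by linarith))),
    sub_eq_zero.1 (norm_eq_zero.1 (pow_eq_zero_iff two_ne_zero |>.1 (by linarith)))⟩

theorem re_ofReal (a : E) : C.re (C.ofReal a) = a :=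
  (C.re_im_eq_of_eq (b := 0) (by simp)).1

theorem im_ofReal (a : E) : C.im (C.ofReal a) = 0 :=
  (C.re_im_eq_of_eq (a := a) (by simp)).2

theorem ofReal_injective : Function.Injective C.ofReal :=
  Function.LeftInverse.injective C.re_ofReal

/-- The real part as a continuous real-linear map. -/
noncomputable def reCLM : H →L[ℝ] E :=
  LinearMap.mkContinuous
    { toFun := C.re
      map_add' := fun z w => (C.re_im_eq_of_eq (b := C.im z + C.im w) (by
        rw [map_add, map_add, smul_add, add_add_add_comm, C.ofReal_re_add_I_smul_ofReal_im,
          C.ofReal_re_add_I_smul_ofReal_im])).1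
      map_smul' := fun r z => (C.re_im_eq_of_eq (b := r • C.im z) (by
        conv_rhs => rw [← C.ofReal_re_add_I_smul_ofReal_im z]
        rw [map_smul, map_smul, smul_add, smul_comm]
        rfl)).1 }
    1 (fun z => by rw [one_mul]; exact C.norm_re_le z)

theorem reCLM_apply (z : H) : C.reCLM z = C.re z := rfl

theorem continuous_re : Continuous C.re := C.reCLM.continuous

theorem continuous_ofReal : Continuous C.ofReal :=
  (LinearMap.mkContinuous C.ofReal 1 fun a => by rw [one_mul, C.norm_ofReal]).continuous

theorem separableSpace (C : Complexification E H) [TopologicalSpace.SeparableSpace H] :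
    TopologicalSpace.SeparableSpace E :=
  (Function.LeftInverse.surjective C.re_ofReal).denseRange.separableSpace C.continuous_re

end Complexification

variable [CompleteSpace E] [Lattice E] [IsOrderedAddMonoid E] [IsOrderedModule ℝ E]
  [HasSolidNorm E]

/-! ### Bounds for the modulus -/

namespace Complexification

theorem abs_re_le_modulus (z : H) : |C.re z| ≤ C.modulus z := by
  have h := (C.isLUB_modulus z).1
  refine abs_le'.2 ⟨?_, ?_⟩
  · simpa using h ⟨0, rfl⟩
  · simpa using h ⟨Real.pi, rfl⟩

theorem abs_im_le_modulus (z : H) : |C.im z| ≤ C.modulus z := by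
  have h := (C.isLUB_modulus z).1
  refine abs_le'.2 ⟨?_, ?_⟩
  · simpa using h ⟨Real.pi / 2, rfl⟩
  · simpa using h ⟨-(Real.pi / 2), rfl⟩

theorem modulus_nonneg (z : H) : 0 ≤ C.modulus z :=
  (abs_nonneg _).trans (C.abs_re_le_modulus z)

theorem modulus_ofReal_le (a : E) : C.modulus (C.ofReal a) ≤ |a| := by
  refine (C.isLUB_modulus _).2 ?_
  rintro _ ⟨θ, rfl⟩
  simpa [C.re_ofReal, C.im_ofReal] using smul_le_abs _ (Real.abs_cos_le_one θ) a

theorem modulus_zero_le (z : H) : C.modulus 0 ≤ C.modulus z := by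
  have := C.modulus_ofReal_le 0
  rw [map_zero, abs_zero] at this
  exact this.trans (C.modulus_nonneg z)

theorem modulus_le (z : H) : C.modulus z ≤ |C.re z| + |C.im z| := by
  refine (C.isLUB_modulus z).2 ?_
  rintro _ ⟨θ, rfl⟩
  exact add_le_add (smul_le_abs _ (Real.abs_cos_le_one θ) _)
    (smul_le_abs _ (Real.abs_sin_le_one θ) _)

end Complexification

/-- An orthogonal projection that maps every positive element `a` of the real part into the order
interval `[0, a]` has a closed ideal as its range. -/
theorem isClosedIdeal_range_of_mem_Icc [CompleteSpace H] {P : H →L[ℂ] H}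
    (hP : IsStarProjection P) (h : ∀ a : E, 0 ≤ a → ∃ b ∈ Icc 0 a, P (C.ofReal a) = C.ofReal b) :
    IsClosedIdeal C P.range := by
  have hmem : ∀ z, z ∈ P.range ↔ P z = z := fun z =>
    ⟨by rintro ⟨w, rfl⟩; exact DFunLike.congr_fun hP.isIdempotentElem w, fun hz => ⟨z, hz⟩⟩
  -- `P a ≤ a` and `P (b - a) ≤ b - a` add up to the equality `P b = b`, so neither can be strict.
  have key : ∀ a b : E, 0 ≤ a → a ≤ b → P (C.ofReal b) = C.ofReal b →
      P (C.ofReal a) = C.ofReal a := by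
    intro a b ha hab hb
    obtain ⟨c, hc, hPc⟩ := h a ha
    obtain ⟨d, hd, hPd⟩ := h (b - a) (sub_nonneg.2 hab)
    have h1 : C.ofReal (c + d) = C.ofReal b := by
      rw [map_add, ← hPc, ← hPd, ← map_add, ← map_add, add_sub_cancel, hb]
    have h2 : c + d = b := C.ofReal_injective h1
    have h3 : a ≤ c := by
      have : b ≤ c + (b - a) := h2 ▸ add_le_add_right hd.2 c
      have h4 := sub_nonneg.2 this
      rw [show c + (b - a) - b = c - a by abel] at h4
      exact sub_nonneg.1 h4
    rw [hPc, le_antisymm hc.2 h3]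
  have hreal : ∀ a : E, ∃ b, P (C.ofReal a) = C.ofReal b := by
    intro a
    obtain ⟨b, -, hb⟩ := h a⁺ (posPart_nonneg a)
    obtain ⟨c, -, hc⟩ := h a⁻ (negPart_nonneg a)
    refine ⟨b - c, ?_⟩
    rw [map_sub, ← hb, ← hc, ← map_sub, ← map_sub, posPart_sub_negPart]
  have habs : ∀ a : E, P (C.ofReal a) = C.ofReal a → P (C.ofReal |a|) = C.ofReal |a| := by
    intro a ha
    obtain ⟨b, hb, hPb⟩ := h a⁺ (posPart_nonneg a)
    obtain ⟨c, hc, hPc⟩ := h a⁻ (negPart_nonneg a)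
    have h1 : a = b - c := C.ofReal_injective <| by
      rw [← ha, map_sub, ← hPb, ← hPc, ← map_sub, ← map_sub, posPart_sub_negPart]
    -- With `b = P a⁺` and `c = P a⁻`, `|a| ≤ b + c ≤ a⁺ + a⁻ = |a|`.
    have h2 : |a| ≤ b + c := by
      rw [h1]
      refine abs_le'.2 ⟨?_, ?_⟩
      · exact (sub_le_self b hc.1).trans (le_add_of_nonneg_right hc.1)
      · rw [neg_sub]
        exact (sub_le_self c hb.1).trans (le_add_of_nonneg_left hb.1)
    have h3 : b + c = |a| := le_antisymm
      ((add_le_add hb.2 hc.2).trans_eq (posPart_add_negPart a)) h2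
    conv_rhs => rw [← h3, map_add, ← hPb, ← hPc]
    rw [← map_add, ← map_add, posPart_add_negPart]
  have hre : ∀ z, P z = z → P (C.ofReal (C.re z)) = C.ofReal (C.re z) ∧
      P (C.ofReal (C.im z)) = C.ofReal (C.im z) := by
    intro z hz
    obtain ⟨b, hb⟩ := hreal (C.re z)
    obtain ⟨c, hc⟩ := hreal (C.im z)
    have h1 : C.ofReal b + Complex.I • C.ofReal c = z := by
      conv_rhs => rw [← hz, ← C.ofReal_re_add_I_smul_ofReal_im z]
      rw [map_add, map_smul, hb, hc]
    obtain ⟨h2, h3⟩ := C.re_im_eq_of_eq h1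
    exact ⟨by rw [hb, h2], by rw [hc, h3]⟩
  have hdom : ∀ a b : E, |a| ≤ b → P (C.ofReal b) = C.ofReal b → P (C.ofReal a) = C.ofReal a := by
    intro a b hab hb
    have h1 := key a⁺ b (posPart_nonneg a)
      ((sup_le (le_abs_self a) (abs_nonneg a)).trans hab) hb
    have h2 := key a⁻ b (negPart_nonneg a)
      ((sup_le (neg_le_abs a) (abs_nonneg a)).trans hab) hb
    rw [← posPart_sub_negPart a, map_sub, map_sub, h1, h2]
  constructor
  · have : (P.range : Set H) = {z | P z = z} := by ext z; exact hmem z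
    rw [this]
    exact isClosed_eq P.continuous continuous_id
  · intro z hz w hw
    obtain ⟨h1, h2⟩ := hre z ((hmem z).1 hz)
    -- This fixed element dominates `C.modulus z`, so it need not be shown that `P` fixes the
    -- modulus itself.
    have h3 : P (C.ofReal (|C.re z| + |C.im z|)) = C.ofReal (|C.re z| + |C.im z|) := by
      rw [map_add, map_add, habs _ h1, habs _ h2]
    have h4 := hw.trans (C.modulus_le z)
    rw [hmem, ← C.ofReal_re_add_I_smul_ofReal_im w, map_add, map_smul,
      hdom _ _ ((C.abs_re_le_modulus w).trans h4) h3,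
      hdom _ _ ((C.abs_im_le_modulus w).trans h4) h3]

/-! ### Projections onto closed ideals of the Bochner space -/

section L2

variable {X : Type*} [MeasurableSpace X] {μ : Measure X}

theorem IsClosedIdealL2.indicator_mem {C : Complexification E H} {I : Submodule ℂ (Lp H 2 μ)}
    (hI : IsClosedIdealL2 C I) {f : Lp H 2 μ} (hf : f ∈ I) {A : Set X} (hA : MeasurableSet A) :
    ((Lp.memLp f).indicator hA).toLp _ ∈ I := by
  refine hI.mem_of_modulus_le f hf _ ?_
  filter_upwards [((Lp.memLp f).indicator hA).coeFn_toLp] with x hx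
  rw [hx]
  by_cases h : x ∈ A
  · rw [indicator_of_mem h]
  · rw [indicator_of_notMem h]
    exact C.modulus_zero_le _

theorem ae_inner_eq_zero_of_mem_orthogonal {C : Complexification E H}
    {I : Submodule ℂ (Lp H 2 μ)} (hI : IsClosedIdealL2 C I) {f g : Lp H 2 μ} (hf : f ∈ I)
    (hg : g ∈ Iᗮ) : ∀ᵐ x ∂μ, ⟪f x, g x⟫_ℂ = 0 := by
  refine (L2.integrable_inner (𝕜 := ℂ) f g).ae_eq_zero_of_forall_setIntegral_eq_zero ?_
  intro A hA _
  have h := (Submodule.mem_orthogonal I g).1 hg _ (hI.indicator_mem hf hA)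
  rw [L2.inner_def] at h
  rw [← h, ← integral_indicator hA]
  refine integral_congr_ae ?_
  filter_upwards [((Lp.memLp f).indicator hA).coeFn_toLp] with x hx
  rw [hx]
  by_cases hxA : x ∈ A
  · rw [indicator_of_mem hxA, indicator_of_mem hxA]
  · rw [indicator_of_notMem hxA, indicator_of_notMem hxA, inner_zero_left]

/-- A projection onto a closed ideal of `L²(μ; H)` maps a positive `f` into `[0, f]`. -/
theorem ae_mem_Icc_of_isClosedIdealL2 [CompleteSpace H] {T : Lp H 2 μ →L[ℂ] Lp H 2 μ}
    (hT : IsStarProjection T) (hI : IsClosedIdealL2 C T.range) {f : Lp H 2 μ}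
    (hf : ∀ᵐ x ∂μ, ∃ a, 0 ≤ a ∧ f x = C.ofReal a) :
    ∀ᵐ x ∂μ, ∃ b ∈ Icc 0 (C.re (f x)), T f x = C.ofReal b := by
  set h : X → H := fun x => C.ofReal ((C.re (T f x))⁺ ⊓ C.re (f x)) with hdef
  have hcont : Continuous fun p : H × H => C.ofReal ((C.re p.1)⁺ ⊓ C.re p.2) := by
    simp only [posPart_def]
    exact C.continuous_ofReal.comp (((C.continuous_re.comp continuous_fst).sup
      continuous_const).inf (C.continuous_re.comp continuous_snd))
  have hmeas : AEStronglyMeasurable h μ := hcont.comp_aestronglyMeasurable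
    ((Lp.aestronglyMeasurable (T f)).prodMk (Lp.aestronglyMeasurable f))
  have hpos : ∀ᵐ x ∂μ, 0 ≤ C.re (f x) := by
    filter_upwards [hf] with x ⟨a, ha, hx⟩
    rwa [hx, C.re_ofReal]
  have habs : ∀ᵐ x ∂μ, |(C.re (T f x))⁺ ⊓ C.re (f x)| ≤ |C.re (T f x)| := by
    filter_upwards [hpos] with x hx
    rw [abs_of_nonneg (le_inf (posPart_nonneg _) hx)]
    exact inf_le_left.trans (sup_le (le_abs_self _) (abs_nonneg _))
  have hLp : MemLp h 2 μ := by
    refine (Lp.memLp (T f)).of_le hmeas ?_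
    filter_upwards [habs] with x hx
    rw [hdef, C.norm_ofReal]
    exact (norm_le_norm_of_abs_le_abs hx).trans (C.norm_re_le _)
  set k : Lp H 2 μ := hLp.toLp h with hk
  have hkmem : k ∈ T.range := by
    refine hI.mem_of_modulus_le (T f) ⟨f, rfl⟩ _ ?_
    filter_upwards [hLp.coeFn_toLp, habs] with x hx hx'
    rw [hk, hx]
    exact (C.modulus_ofReal_le _).trans (hx'.trans (C.abs_re_le_modulus _))
  have hle : ‖f - k‖ ≤ ‖f - T f‖ := by
    refine Lp.norm_le_norm_of_ae_le ?_
    filter_upwards [hLp.coeFn_toLp, hf, Lp.coeFn_sub f k, Lp.coeFn_sub f (T f)]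
      with x hx ⟨a, ha, hfx⟩ h1 h2
    rw [h1, h2, Pi.sub_apply, Pi.sub_apply, hk, hx, hdef]
    simp only [hfx, C.re_ofReal]
    rw [← map_sub, C.norm_ofReal]
    -- The left side is `(a - (C.re (T f x))⁺) ⊔ 0`.
    have h3 : |a - (C.re (T f x))⁺ ⊓ a| ≤ |a - C.re (T f x)| := by
      rw [abs_of_nonneg (sub_nonneg.2 inf_le_right), sub_inf, sub_self]
      exact sup_le ((sub_le_sub_left (le_posPart _) a).trans (le_abs_self _)) (abs_nonneg _)
    refine (norm_le_norm_of_abs_le_abs h3).trans ?_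
    have h4 : C.re (C.ofReal a - T f x) = a - C.re (T f x) := by
      rw [← C.reCLM_apply, map_sub, C.reCLM_apply, C.reCLM_apply, C.re_ofReal]
    rw [← h4]
    exact C.norm_re_le _
  -- `T f` is the unique point of the range nearest to `f`, by Pythagoras.
  have hkT : k = T f := by
    obtain ⟨g, hg⟩ := hkmem
    obtain ⟨_, hT'⟩ := isStarProjection_iff_eq_starProjection_range.1 hT
    have horth : ⟪f - T f, T f - k⟫_ℂ = 0 := by
      have hm : T f - k ∈ T.range := ⟨f - g, by rw [← hg]; exact map_sub T f g⟩
      have h5 := Submodule.sub_starProjection_mem_orthogonal (K := T.range) f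
      rw [← hT'] at h5
      exact (Submodule.mem_orthogonal' _ _).1 h5 _ hm
    have h6 := norm_add_sq_eq_norm_sq_add_norm_sq_of_inner_eq_zero _ _ horth
    rw [sub_add_sub_cancel] at h6
    have h7 : ‖T f - k‖ = 0 := by nlinarith [norm_nonneg (f - k), norm_nonneg (T f - k)]
    exact (sub_eq_zero.1 (norm_eq_zero.1 h7)).symm
  filter_upwards [hLp.coeFn_toLp, hpos] with x hx hx'
  refine ⟨_, ⟨le_inf (posPart_nonneg (C.re (T f x))) hx', inf_le_right⟩, ?_⟩
  exact (congrArg (fun g : Lp H 2 μ => g x) hkT).symm.trans hx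

/-- Nonzero constants need not lie in `L²`, so vectors of `H` are tested on sets of finite measure
exhausting `X`. -/
theorem ae_of_forall_ae_mem_spanningSets [SigmaFinite μ] {p : X → Prop}
    (h : ∀ n, ∀ᵐ x ∂μ, x ∈ spanningSets μ n → p x) : ∀ᵐ x ∂μ, p x := by
  filter_upwards [ae_all_iff.2 h] with x hx
  exact hx _ (mem_spanningSetsIndex μ x)

theorem ae_apply_indicatorConstLp_eq [SigmaFinite μ] {T : Lp H 2 μ →L[ℂ] Lp H 2 μ}
    {P : X → H →L[ℂ] H} (hP : ∀ f : Lp H 2 μ, ∀ᵐ x ∂μ, T f x = P x (f x)) (v : H) (n : ℕ) :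
    ∀ᵐ x ∂μ, x ∈ spanningSets μ n → T (indicatorConstLp 2 (measurableSet_spanningSets μ n)
      (measure_spanningSets_lt_top μ n).ne v) x = P x v := by
  filter_upwards [hP _, indicatorConstLp_coeFn (p := 2) (hs := measurableSet_spanningSets μ n)
    (hμs := (measure_spanningSets_lt_top μ n).ne) (c := v)] with x h1 h2 hx
  rw [h1, h2, indicator_of_mem hx]

variable [CompleteSpace H]

/-- The fibres of a projection onto a closed ideal of `L²(μ; H)` are almost everywhere projections
onto closed ideals of `H`. -/
theorem ActsThrough.ae_isClosedIdeal [SigmaFinite μ] [TopologicalSpace.SeparableSpace H]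
    {T : Lp H 2 μ →L[ℂ] Lp H 2 μ} (hT : IsStarProjection T) (hI : IsClosedIdealL2 C T.range)
    {P : X → H →L[ℂ] H} (hP : ActsThrough T P) : ∀ᵐ x ∂μ, IsClosedIdeal C (P x).range := by
  have := C.separableSpace
  have key : ∀ a : E, 0 ≤ a → ∀ᵐ x ∂μ, ∃ b ∈ Icc 0 a, P x (C.ofReal a) = C.ofReal b := by
    intro a ha
    refine ae_of_forall_ae_mem_spanningSets fun n => ?_
    have hind := indicatorConstLp_coeFn (p := 2) (hs := measurableSet_spanningSets μ n)
      (hμs := (measure_spanningSets_lt_top μ n).ne) (c := C.ofReal a)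
    have hIcc := ae_mem_Icc_of_isClosedIdealL2 C hT hI (f := indicatorConstLp 2
      (measurableSet_spanningSets μ n) (measure_spanningSets_lt_top μ n).ne (C.ofReal a)) (by
        filter_upwards [hind] with x hx
        rw [hx]
        by_cases hxn : x ∈ spanningSets μ n
        · exact ⟨a, ha, indicator_of_mem hxn _⟩
        · exact ⟨0, le_rfl, by rw [indicator_of_notMem hxn, map_zero]⟩)
    filter_upwards [hind, hIcc, ae_apply_indicatorConstLp_eq hP.ae_eq (C.ofReal a) n]
      with x h1 ⟨b, hb, hTb⟩ h3 hx
    rw [h1, indicator_of_mem hx, C.re_ofReal] at hb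
    exact ⟨b, hb, by rw [← h3 hx, hTb]⟩
  have hdense := ae_all_iff.2 fun n =>
    key (TopologicalSpace.denseSeq E n)⁺ (posPart_nonneg _)
  filter_upwards [hdense] with x hx
  refine isClosedIdeal_range_of_mem_Icc C (hP.isStarProjection x) fun a ha => ?_
  have hpos : Continuous fun c : E => c⁺ := by
    simp only [posPart_def]
    exact continuous_id.sup continuous_const
  have hPc : Continuous fun c : E => P x (C.ofReal c⁺) :=
    (P x).continuous.comp (C.continuous_ofReal.comp hpos)
  -- Using `c⁺` makes the condition meaningful for every `c`, so density in `E` suffices; taking the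
  -- real part as witness makes it closed.
  have hclosed : IsClosed {c : E | C.ofReal (C.re (P x (C.ofReal c⁺))) = P x (C.ofReal c⁺) ∧
      0 ≤ C.re (P x (C.ofReal c⁺)) ∧ C.re (P x (C.ofReal c⁺)) ≤ c⁺} :=
    (isClosed_eq (C.continuous_ofReal.comp (C.continuous_re.comp hPc)) hPc).inter
      ((isClosed_le continuous_const (C.continuous_re.comp hPc)).inter
        (isClosed_le (C.continuous_re.comp hPc) hpos))
  have hall := (hclosed.closure_subset_iff (s := range (TopologicalSpace.denseSeq E))).2 (by
    rintro _ ⟨n, rfl⟩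
    obtain ⟨b, hb, hPb⟩ := hx n
    rw [mem_ofPred_eq, hPb, C.re_ofReal]
    exact ⟨rfl, hb.1, hb.2⟩)
  obtain ⟨h1, h2, h3⟩ := hall (TopologicalSpace.denseRange_denseSeq E a)
  rw [posPart_of_nonneg ha] at h1 h2 h3
  exact ⟨_, ⟨h2, h3⟩, h1.symm⟩

/-- A projection onto a closed ideal of `L²(μ; H)` acts pointwise through the projections onto
the closed spans of the values of a dense sequence of the ideal. -/
theorem strictlyLocal_of_isClosedIdealL2 [SigmaFinite μ] [MeasurableSpace.CountablyGenerated X]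
    [TopologicalSpace.SeparableSpace H] {T : Lp H 2 μ →L[ℂ] Lp H 2 μ}
    (hT : IsStarProjection T) (hI : IsClosedIdealL2 C T.range) : StrictlyLocal T := by
  have : Fact ((2 : ℝ≥0∞) ≠ ∞) := ⟨ENNReal.ofNat_ne_top⟩
  set d : ℕ → Lp H 2 μ := fun n => T (TopologicalSpace.denseSeq (Lp H 2 μ) n) with hd
  set K : X → Submodule ℂ H := fun x =>
    (Submodule.span ℂ (range fun n => d n x)).topologicalClosure with hK
  have hKcomplete : ∀ x, CompleteSpace (K x) := fun x =>
    (Submodule.isClosed_topologicalClosure _).completeSpace_coe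
  obtain ⟨_, hT'⟩ := isStarProjection_iff_eq_starProjection_range.1 hT
  have hmem : ∀ f : Lp H 2 μ, ∀ᵐ x ∂μ, T f x ∈ K x := by
    intro f
    have hcl : T f ∈ closure (range d) := by
      have h1 : range d = T '' range (TopologicalSpace.denseSeq (Lp H 2 μ)) := range_comp _ _
      rw [h1]
      exact image_closure_subset_closure_image T.continuous
        ⟨f, TopologicalSpace.denseRange_denseSeq _ f, rfl⟩
    obtain ⟨u, hu, hlim⟩ := mem_closure_iff_seq_limit.1 hcl
    -- Norm convergence gives pointwise convergence a.e. only along a subsequence, which is enough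
    -- as `K x` is closed.
    obtain ⟨φ, -, hφ⟩ := (tendstoInMeasure_of_tendsto_Lp hlim).exists_seq_tendsto_ae
    filter_upwards [hφ] with x hx
    refine (Submodule.isClosed_topologicalClosure _).mem_of_tendsto hx (Eventually.of_forall ?_)
    intro i
    obtain ⟨n, hn⟩ := hu (φ i)
    rw [← hn]
    exact Submodule.le_topologicalClosure _ (Submodule.subset_span ⟨n, rfl⟩)
  have hae : ∀ f : Lp H 2 μ, ∀ᵐ x ∂μ, T f x = (K x).starProjection (f x) := by
    intro f
    have horth : ∀ n, ∀ᵐ x ∂μ, ⟪d n x, (f - T f : Lp H 2 μ) x⟫_ℂ = 0 := by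
      intro n
      have h5 := Submodule.sub_starProjection_mem_orthogonal (K := T.range) f
      rw [← hT'] at h5
      exact ae_inner_eq_zero_of_mem_orthogonal hI ⟨_, rfl⟩ h5
    filter_upwards [hmem f, ae_all_iff.2 horth, Lp.coeFn_sub f (T f)] with x h1 h2 h3
    refine (Submodule.eq_starProjection_of_mem_orthogonal h1 ?_).symm
    rw [h3, Pi.sub_apply] at h2
    rw [hK, Submodule.orthogonal_closure, Submodule.mem_orthogonal]
    intro u hu
    induction hu using Submodule.span_induction with
    | mem y hy => obtain ⟨n, rfl⟩ := hy; exact h2 n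
    | zero => exact inner_zero_left _
    | add y z _ _ hy hz => rw [inner_add_left, hy, hz, add_zero]
    | smul c y _ hy => rw [inner_smul_left, hy, mul_zero]
  refine ⟨fun x => (K x).starProjection, fun x => isStarProjection_starProjection, fun v => ?_, hae⟩
  -- On each spanning set the field applied to `v` agrees a.e. with `T` of an indicator times `v`,
  -- which is measurable.
  rw [← Measure.restrict_univ (μ := μ), ← iUnion_spanningSets μ, aestronglyMeasurable_iUnion_iff]
  intro n
  refine (Lp.aestronglyMeasurable (T (indicatorConstLp 2 (measurableSet_spanningSets μ n)
    (measure_spanningSets_lt_top μ n).ne v))).restrict.congr ?_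
  exact (ae_restrict_iff' (measurableSet_spanningSets μ n)).2
    (ae_apply_indicatorConstLp_eq hae v n)

end L2

end Complexification

end HilbertLattice

theorem mainTheorem1 (N : ℕ) {E H : Type*}
    [NormedAddCommGroup E] [InnerProductSpace ℝ E] [CompleteSpace E]
    [Lattice E] [IsOrderedAddMonoid E] [IsOrderedModule ℝ E] [HasSolidNorm E]
    [NormedAddCommGroup H] [InnerProductSpace ℂ H] [CompleteSpace H]
    [TopologicalSpace.SeparableSpace H]
    (C : Complexification E H)
    (T : Lp H 2 (volume : Measure (EuclideanSpace ℝ (Fin N))) →L[ℂ]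
      Lp H 2 (volume : Measure (EuclideanSpace ℝ (Fin N))))
    (hT : IsStarProjection T)
    (hI : IsClosedIdealL2 C T.range) :
    StrictlyLocal T ∧
      ∀ P : EuclideanSpace ℝ (Fin N) → H →L[ℂ] H, ActsThrough T P →
        ∀ᵐ x, IsClosedIdeal C (P x).range := by
  exact ⟨strictlyLocal_of_isClosedIdealL2 C hT hI, fun _ hP => hP.ae_isClosedIdeal C hT hI⟩
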